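/- All topological groups are Hausdorff. For a topological group $G$ let $c(G)$ denote the connected component of its neutral element, and for a topological space $X$ let $w(X)$ denote its weight, i.e. the least cardinality of a base of the topology of $X$. A subgroup $H$ of a topological Abelian group $G$ is called \emph{locally essential} in $G$ if there is a neighbourhood $V$ of $0$ in $G$ such that $H \cap N \neq \{0\}$ for every non-trivial closed subgroup $N$ of $G$ contained in $V$. A subgroup of $G$ is a \emph{$G_\delta$-subgroup} if it is a countable intersection of open subsets of $G$. Finally, $\dim$ denotes the Lebesgue covering dimension. Let $K$ be a compact Abelian group and let $M$ be a closed subgroup of $K$. Suppose that at least one of the following two conditions holds: (a) $M$ is a $G_\delta$-subgroup of $K$ and $c(M) \neq \{0\}$; (b) $M$ is a locally essential subgroup of $K$ and $\dim K$ is infinite. Then $w(c(M)) = w(c(K))$. -/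

import Mathlib

open Topology TopologicalSpace

universe u

noncomputable section

/-- The weight of a topological space: the least cardinality of a base of its topology. -/
def weight (X : Type u) [TopologicalSpace X] : Cardinal.{u} :=
  sInf {κ : Cardinal.{u} | ∃ B : Set (Set X), IsTopologicalBasis B ∧ Cardinal.mk B = κ}

/-- Every finite open cover of `X` has a finite open refinement (again covering `X`) such that
every point of `X` lies in at most `n` of its members; that is, the Lebesgue covering dimension
of `X` is less than `n`. -/
def HasCoveringDimensionLT (X : Type u) [TopologicalSpace X] (n : ℕ) : Prop :=
  ∀ U : Set (Set X), U.Finite → (∀ u ∈ U, IsOpen u) → ⋃₀ U = Set.univ →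
    ∃ V : Set (Set X), V.Finite ∧ (∀ v ∈ V, IsOpen v) ∧ ⋃₀ V = Set.univ ∧
      (∀ v ∈ V, ∃ u ∈ U, v ⊆ u) ∧ ∀ x : X, {v ∈ V | x ∈ v}.encard ≤ n

/-- The Lebesgue covering dimension. The empty space has dimension `⊥` (that is, `-1`), and the
value `⊤` means that the dimension is infinite. -/
def coveringDimension (X : Type u) [TopologicalSpace X] : WithBot ℕ∞ :=
  sInf {d : WithBot ℕ∞ | ∀ n : ℕ, d < n → HasCoveringDimensionLT X n}

/-- A subgroup `H` of a topological group `G` is locally essential if there is a neighbourhood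
`V` of the neutral element such that `H` meets non-trivially every non-trivial closed normal
subgroup of `G` that is contained in `V`. -/
def IsLocallyEssential {G : Type u} [AddGroup G] [TopologicalSpace G] (H : AddSubgroup G) : Prop :=
  ∃ V ∈ 𝓝 (0 : G), ∀ N : AddSubgroup G, N.Normal → IsClosed (N : Set G) → N ≠ ⊥ →
    (N : Set G) ⊆ V → H ⊓ N ≠ ⊥

end

/-!
A compact Abelian group is governed by its continuous characters: they separate points, and
`A ↦ A^⊥` loses nothing about a subgroup `A` of the dual. The dual of a connected compact group is
torsion-free, so if `A^⊥` is totally disconnected then every character has a non-zero multiple in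
the subgroup generated by `A`; hence for infinite `A` the weight of the group is at most `#A`.

If `M` is a `G_δ`-subgroup, it contains `B^⊥` for a countable set `B` of characters. Adding `B` to
a set `A` of at most `w(c(M))` characters separating `c(M)` from `0` makes `(A ∪ B)^⊥` totally
disconnected, and `w(c(K)) ≤ w(c(M))` follows.

If `M` is locally essential, then `M^⊥` has finite rank: otherwise a homomorphism from the dual to
`ℚ` that kills the finitely many characters defining the neighbourhood is still onto on `M^⊥`, and
the coannihilator of its kernel is a small closed subgroup meeting `M` trivially. So there is a
finite set `S` of characters such that connected subsets of `S^⊥` through `0` lie in `M`, and the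
previous argument applies with `B = S`, provided that `c(M) ≠ 0`. If `c(M) = 0`, then `S^⊥` is
totally disconnected, and the map `K → ℝ^(2 #S)` given by `S` has totally disconnected fibres;
disjoint finite covers of the fibres show that the dimension of `K` is finite.
-/

/-! ### Continuous characters separate the points of a compact Abelian group -/

section PeterWeyl

open MeasureTheory InnerProductSpace

theorem exists_forall_eq_smul_of_finiteDimensional {k G V : Type*} [Field k] [IsAlgClosed k]
    [CommMonoid G] [AddCommGroup V] [Module k V] [FiniteDimensional k V] [Nontrivial V]
    (ρ : Representation k G V) : ∃ w : V, w ≠ 0 ∧ ∃ c : G → k, ∀ g, ρ g w = c g • w := by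
  have : Module.Finite k ρ.asModule := inferInstanceAs (Module.Finite k V)
  have : Nontrivial ρ.asModule := inferInstanceAs (Nontrivial V)
  have : IsArtinian (MonoidAlgebra k G) ρ.asModule := isArtinian_of_tower k inferInstance
  obtain ⟨S, hS⟩ := IsAtomic.exists_atom (Submodule (MonoidAlgebra k G) ρ.asModule)
  have : IsSimpleModule (MonoidAlgebra k G) S := isSimpleModule_iff_isAtom.2 hS
  have : FiniteDimensional k S :=
    inferInstanceAs (FiniteDimensional k (S.restrictScalars k))
  have hrank := IsSimpleModule.finrank_eq_one_of_isMulCommutative (MonoidAlgebra k G) S k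
  obtain ⟨w, hw, hspan⟩ := finrank_eq_one_iff'.1 hrank
  have hsmul (g : G) : ∃ c : k, c • w = MonoidAlgebra.of k G g • w := hspan _
  choose c hc using hsmul
  refine ⟨ρ.asModuleEquiv w, by simpa using hw, c, fun g ↦ ?_⟩
  rw [← map_smul, ← Submodule.coe_smul_of_tower, hc, Submodule.coe_smul,
    Representation.asModuleEquiv_map_smul]
  simp

variable {G H : Type*} [Group G] [NormedAddCommGroup H] [InnerProductSpace ℂ H]

variable {U : G →* (H →ₗᵢ[ℂ] H)} [TopologicalSpace G]

theorem exists_circleHom_of_forall_eq_smul (hU : ∀ v, Continuous fun g ↦ U g v) {w : H}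
    (hw : w ≠ 0) {c : G → ℂ} (hc : ∀ g, U g w = c g • w) :
    ∃ χ : G →ₜ* Circle, ∀ g, U g w = (χ g : ℂ) • w := by
  have hinj : Function.Injective fun z : ℂ ↦ z • w := smul_left_injective ℂ hw
  have hnorm (g : G) : ‖c g‖ = 1 := by
    have : ‖c g‖ * ‖w‖ = ‖w‖ := by rw [← norm_smul, ← hc, (U g).norm_map]
    exact mul_eq_right₀ (norm_ne_zero_iff.2 hw) |>.1 this
  have hcont : Continuous c := by
    have : c = fun g ↦ inner ℂ w (U g w) / inner ℂ w w := by
      ext g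
      rw [hc, inner_smul_right, mul_div_cancel_right₀ _ (inner_self_ne_zero.2 hw)]
    rw [this]
    exact (continuous_const.inner (hU w)).div_const _
  refine ⟨⟨⟨⟨fun g ↦ ⟨c g, mem_sphere_zero_iff_norm.2 (hnorm g)⟩, ?_⟩, fun g h ↦ ?_⟩,
    hcont.subtype_mk _⟩, hc⟩
  · refine Circle.ext (hinj ?_)
    simpa using (hc 1).symm
  · refine Circle.ext (hinj ?_)
    simpa [hc, smul_smul, mul_comm] using! (hc (g * h)).symm

theorem continuous_rankOne_orbit (hU : ∀ v, Continuous fun g ↦ U g v) (v : H) :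
    Continuous fun g ↦ rankOne ℂ (U g v) (U g v) := by
  simp only [rankOne_def']
  exact (ContinuousLinearMap.toSpanSingletonCLE.continuous.comp (hU v)).clm_comp
    ((innerSL ℂ).continuous.comp (hU v))

variable [MeasurableSpace G] (μ : Measure G)

/-- The average over `G` of the rank-one operators `x ↦ ⟪U g v, x⟫ U g v`. It is a compact
self-adjoint operator commuting with the representation `U`; its eigenspaces are the source of
finite-dimensional invariant subspaces. -/
noncomputable def orbitAverage (U : G →* (H →ₗᵢ[ℂ] H)) (v : H) : H →L[ℂ] H :=
  ∫ g, rankOne ℂ (U g v) (U g v) ∂μ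

variable {μ} [CompactSpace G] [BorelSpace G]

theorem integrable_rankOne_orbit [IsFiniteMeasure μ] (hU : ∀ v, Continuous fun g ↦ U g v) (v : H) :
    Integrable (fun g ↦ rankOne ℂ (U g v) (U g v)) μ :=
  (continuous_rankOne_orbit hU v).integrable_of_hasCompactSupport
    (HasCompactSupport.of_compactSpace _)

theorem orbitAverage_apply [IsFiniteMeasure μ] (hU : ∀ v, Continuous fun g ↦ U g v) (v x : H) :
    orbitAverage μ U v x = ∫ g, inner ℂ (U g v) x • U g v ∂μ := by
  rw [orbitAverage, ContinuousLinearMap.integral_apply (integrable_rankOne_orbit hU v)]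
  simp only [rankOne_apply]

theorem integrable_inner_smul_orbit [IsFiniteMeasure μ] (hU : ∀ v, Continuous fun g ↦ U g v)
    (v x : H) : Integrable (fun g ↦ inner ℂ (U g v) x • U g v) μ :=
  (integrable_rankOne_orbit hU v).apply_continuousLinearMap x

theorem orbitAverage_eq_zero_of_forall_inner_eq_zero [IsFiniteMeasure μ]
    (hU : ∀ v, Continuous fun g ↦ U g v) {v x : H} (h : ∀ g, inner ℂ (U g v) x = 0) :
    orbitAverage μ U v x = 0 := by
  simp [orbitAverage_apply hU, h]

variable [CompleteSpace H]

theorem inner_orbitAverage [IsFiniteMeasure μ] (hU : ∀ v, Continuous fun g ↦ U g v) (v x y : H) :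
    inner ℂ x (orbitAverage μ U v y) = ∫ g, inner ℂ x (U g v) * inner ℂ (U g v) y ∂μ := by
  rw [orbitAverage_apply hU, ← integral_inner (integrable_inner_smul_orbit hU v y)]
  simp only [inner_smul_right, mul_comm]

theorem isSymmetric_orbitAverage [IsFiniteMeasure μ] (hU : ∀ v, Continuous fun g ↦ U g v) (v : H) :
    (orbitAverage μ U v).IsSymmetric := by
  intro x y
  change inner ℂ (orbitAverage μ U v x) y = inner ℂ x (orbitAverage μ U v y)
  rw [← inner_conj_symm, inner_orbitAverage hU, inner_orbitAverage hU, ← integral_conj]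
  simp only [map_mul, inner_conj_symm, mul_comm]

theorem isCompactOperator_orbitAverage [IsProbabilityMeasure μ]
    (hU : ∀ v, Continuous fun g ↦ U g v) (v : H) : IsCompactOperator (orbitAverage μ U v) := by
  have hmem := (compactOperator (RingHom.id ℂ) H H).restrictScalars ℝ |>.convex.integral_mem
    (μ := μ) (isClosed_setOfPred_isCompactOperator (σ₁₂ := RingHom.id ℂ) (M₁ := H) (M₂ := H))
    (.of_forall fun g ↦ ?_) (integrable_rankOne_orbit hU v)
  · exact hmem
  · exact (isCompactOperator_of_locallyCompactSpace_rng
      (ContinuousLinearMap.toSpanSingleton ℂ (U g v))).comp_clm (innerSL ℂ (U g v))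

theorem orbitAverage_map [IsTopologicalGroup G] [IsFiniteMeasure μ] [μ.IsMulLeftInvariant]
    (hU : ∀ v, Continuous fun g ↦ U g v) (v x : H) (a : G) :
    orbitAverage μ U v (U a x) = U a (orbitAverage μ U v x) := by
  rw [orbitAverage_apply hU, orbitAverage_apply hU,
    ← integral_mul_left_eq_self _ a]
  change _ = (U a).toContinuousLinearMap _
  rw [← ContinuousLinearMap.integral_comp_comm _ (integrable_inner_smul_orbit hU v x)]
  simp [LinearIsometry.inner_map_map]

theorem orbitAverage_ne_zero [IsFiniteMeasure μ] [μ.IsOpenPosMeasure]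
    (hU : ∀ v, Continuous fun g ↦ U g v) {v : H} (hv : v ≠ 0) : orbitAverage μ U v ≠ 0 := by
  intro h
  have := hU v
  have hcont : Continuous fun g ↦ ‖inner ℂ v (U g v)‖ ^ 2 := by fun_prop
  have hint : ∫ g, ‖inner ℂ v (U g v)‖ ^ 2 ∂μ = 0 := by
    have h0 := inner_orbitAverage (μ := μ) hU v v v
    simp only [← inner_conj_symm (U _ v) v, RCLike.mul_conj] at h0
    rw [← Complex.ofReal_inj, ← integral_complex_ofReal]
    simpa [h] using! h0.symm
  have := hcont.integral_pos_of_hasCompactSupport_nonneg_nonzero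
    (HasCompactSupport.of_compactSpace _) (μ := μ) (fun g ↦ by positivity) (x := 1) (by simpa)
  exact this.ne' hint

end PeterWeyl

section CompactAbelian

open MeasureTheory

variable {G H : Type*} [CommGroup G] [TopologicalSpace G] [IsTopologicalGroup G] [CompactSpace G]
  [NormedAddCommGroup H] [InnerProductSpace ℂ H] [CompleteSpace H] {U : G →* (H →ₗᵢ[ℂ] H)}

theorem exists_circleHom_eigenvector_orbitAverage [MeasurableSpace G] [BorelSpace G]
    {μ : Measure G} [IsProbabilityMeasure μ] [μ.IsMulLeftInvariant] [μ.IsOpenPosMeasure]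
    (hU : ∀ v, Continuous fun g ↦ U g v) {v : H} (hv : v ≠ 0) :
    ∃ w : H, w ≠ 0 ∧ (∃ z : ℂ, z ≠ 0 ∧ orbitAverage μ U v w = z • w) ∧
      ∃ χ : G →ₜ* Circle, ∀ g, U g w = (χ g : ℂ) • w := by
  let T := orbitAverage μ U v
  have hT : IsCompactOperator T := isCompactOperator_orbitAverage hU v
  obtain ⟨z, hz, hz0⟩ : ∃ z, Module.End.HasEigenvalue (T : Module.End ℂ H) z ∧ z ≠ 0 := by
    by_contra! h
    exact orbitAverage_ne_zero hU hv
      ((T.eq_zero_of_forall_hasEigenvalue_eq_zero hT (isSymmetric_orbitAverage hU v)).1 h)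
  let E := Module.End.eigenspace (T : Module.End ℂ H) z
  have : FiniteDimensional ℂ E := T.finite_dimensional_eigenspace hT z hz0
  have : Nontrivial E := (Submodule.nontrivial_iff_ne_bot).2 hz
  have hinv (g : G) : ∀ x ∈ E, (U g).toLinearMap x ∈ E := by
    intro x hx
    rw [Module.End.mem_eigenspace_iff] at hx ⊢
    exact (orbitAverage_map hU v x g).trans (by simpa using congrArg (U g) hx)
  let ρ : Representation ℂ G E :=
    { toFun := fun g ↦ (U g).toLinearMap.restrict (hinv g)
      map_one' := by ext; simp
      map_mul' := fun g h ↦ by ext; simp }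
  obtain ⟨w, hw, c, hc⟩ := exists_forall_eq_smul_of_finiteDimensional ρ
  refine ⟨w, by simpa using hw, ⟨z, hz0, Module.End.mem_eigenspace_iff.1 w.2⟩, ?_⟩
  exact exists_circleHom_of_forall_eq_smul hU (by simpa using hw)
    fun g ↦ congrArg Subtype.val (hc g)

theorem exists_circleHom_apply_ne_one_of_map_ne_one (hU : ∀ v, Continuous fun g ↦ U g v)
    {a : G} (ha : U a ≠ 1) : ∃ χ : G →ₜ* Circle, χ a ≠ 1 := by
  borelize G
  let μ : Measure G := .haarMeasure ⊤
  have : IsProbabilityMeasure μ := ⟨Measure.haarMeasure_self⟩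
  obtain ⟨u, hu⟩ : ∃ u, U a u ≠ u := by
    by_contra! h
    exact ha (LinearIsometry.ext h)
  -- `U a u - u` is orthogonal to the fixed vectors of `U a`.
  obtain ⟨w, hw, ⟨z, hz, hTw⟩, χ, hχ⟩ :=
    exists_circleHom_eigenvector_orbitAverage (μ := μ) hU (sub_ne_zero.2 hu)
  refine ⟨χ, fun hχa ↦ smul_ne_zero hz hw ?_⟩
  have hwa : U a w = w := by rw [hχ, hχa, Circle.coe_one, one_smul]
  have horth : inner ℂ (U a u - u) w = 0 := by
    nth_rw 1 [inner_sub_left, ← hwa, (U a).inner_map_map, sub_self]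
  rw [← hTw]
  refine orbitAverage_eq_zero_of_forall_inner_eq_zero hU fun g ↦ ?_
  have hwg : w = (χ g : ℂ)⁻¹ • U g w := by rw [hχ, inv_smul_smul₀ (Circle.coe_ne_zero _)]
  rw [hwg, inner_smul_right, (U g).inner_map_map, horth, mul_zero]

end CompactAbelian

section RegularRepresentation

open MeasureTheory

variable {G : Type*} [CommGroup G] [TopologicalSpace G] [IsTopologicalGroup G]

/-- The representation of `G` on `L²(G)` by translations. -/
noncomputable def regularRepresentation [MeasurableSpace G] [BorelSpace G] (μ : Measure G)
    [μ.IsMulLeftInvariant] : G →* (Lp ℂ 2 μ →ₗᵢ[ℂ] Lp ℂ 2 μ) where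
  toFun a := Lp.compMeasurePreservingₗᵢ ℂ (a * ·) (measurePreserving_mul_left μ a)
  map_one' := by
    ext1 f
    refine Eq.trans ?_ (Lp.compMeasurePreserving_id_apply f)
    simp [Lp.compMeasurePreservingₗᵢ, Lp.compMeasurePreservingₗ, Function.id_def]
  map_mul' a b := by
    ext1 f
    refine Eq.trans ?_ (Lp.compMeasurePreserving_comp_apply f (measurePreserving_mul_left μ b)
      (measurePreserving_mul_left μ a))
    simp [Lp.compMeasurePreservingₗᵢ, Lp.compMeasurePreservingₗ, Function.comp_def, mul_assoc,
      mul_comm a b]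

variable [CompactSpace G] [MeasurableSpace G] [BorelSpace G] (μ : Measure G)
    [μ.IsMulLeftInvariant]

theorem continuous_regularRepresentation_apply [IsFiniteMeasure μ] (f : Lp ℂ 2 μ) :
    Continuous fun a ↦ regularRepresentation μ a f := by
  let F : C(G, C(G, G)) := ContinuousMap.curry ⟨fun p : G × G ↦ p.1 * p.2, by fun_prop⟩
  exact (continuous_const (y := f)).compMeasurePreservingLp F.continuous
    (measurePreserving_mul_left μ) (by simp)

theorem regularRepresentation_ne_one [T2Space G] [IsFiniteMeasure μ] [μ.IsOpenPosMeasure]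
    {a : G} (ha : a ≠ 1) : regularRepresentation μ a ≠ 1 := by
  intro h
  obtain ⟨f, hfa, hf1, -⟩ := exists_continuous_zero_one_of_isClosed
    (isClosed_singleton (x := a)) (isClosed_singleton (x := (1 : G))) (by simpa using ha)
  let F : C(G, ℂ) := ⟨fun y ↦ (f y : ℂ), by fun_prop⟩
  have htranslate : ContinuousMap.toLp 2 μ ℂ (F.comp ⟨fun x ↦ a * x, by fun_prop⟩) =
      ContinuousMap.toLp 2 μ ℂ F :=
    DFunLike.congr_fun h (ContinuousMap.toLp 2 μ ℂ F)
  have hval : f a = f 1 := by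
    simpa [F] using DFunLike.congr_fun (ContinuousMap.toLp_injective μ htranslate) 1
  rw [hfa rfl, hf1 rfl] at hval
  exact zero_ne_one hval

end RegularRepresentation

theorem exists_circleHom_apply_ne_one {G : Type*} [CommGroup G] [TopologicalSpace G]
    [IsTopologicalGroup G] [CompactSpace G] [T2Space G] {a : G} (ha : a ≠ 1) :
    ∃ χ : G →ₜ* Circle, χ a ≠ 1 := by
  borelize G
  let μ : MeasureTheory.Measure G := .haarMeasure ⊤
  exact exists_circleHom_apply_ne_one_of_map_ne_one
    (continuous_regularRepresentation_apply μ) (regularRepresentation_ne_one μ ha)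

/-- The group of continuous characters of an additive topological group, with values in `ℝ ⧸ ℤ`. -/
abbrev DualGroup (G : Type*) [AddCommGroup G] [TopologicalSpace G] := G →ₜ+ UnitAddCircle

theorem exists_dualGroup_apply_ne_zero {G : Type*} [AddCommGroup G] [TopologicalSpace G]
    [IsTopologicalAddGroup G] [CompactSpace G] [T2Space G] {a : G} (ha : a ≠ 0) :
    ∃ χ : DualGroup G, χ a ≠ 0 := by
  have : T2Space (Multiplicative G) := inferInstanceAs (T2Space G)
  obtain ⟨χ, hχ⟩ := exists_circleHom_apply_ne_one (a := Multiplicative.ofAdd a) (by simpa using ha)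
  let e := AddCircle.homeomorphCircle (T := (1 : ℝ)) one_ne_zero
  have he (z : Circle) : AddCircle.toCircle (e.symm z) = z := by
    rw [← AddCircle.homeomorphCircle_apply one_ne_zero, e.apply_symm_apply]
  refine ⟨⟨AddMonoidHom.mk' (fun x ↦ e.symm (χ (.ofAdd x))) fun x y ↦ ?_, ?_⟩, fun h ↦ hχ ?_⟩
  · refine AddCircle.injective_toCircle one_ne_zero ?_
    simp only [AddCircle.toCircle_add, he, ofAdd_add, map_mul]
  · exact e.symm.continuous.comp ((map_continuous χ).comp continuous_ofAdd)
  · rw [← he (χ _)]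
    exact (congrArg AddCircle.toCircle h).trans AddCircle.toCircle_zero

/-! ### Annihilator duality for compact Abelian groups -/

section Annihilator

variable {G : Type*} [AddCommGroup G] [TopologicalSpace G]

/-- The subgroup of characters vanishing on `M`, often written `M^⊥`. -/
def dualAnnihilator (M : Set G) : AddSubgroup (DualGroup G) where
  carrier := {χ | ∀ x ∈ M, χ x = 0}
  zero_mem' _ _ := rfl
  add_mem' {χ ψ} hχ hψ x hx := by
    rw [ContinuousAddMonoidHom.add_apply, hχ x hx, hψ x hx, add_zero]
  neg_mem' {χ} hχ x hx := (congrArg Neg.neg (hχ x hx)).trans neg_zero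

/-- The subgroup of points at which all characters in `A` vanish, often written `A^⊥`. -/
def dualCoannihilator (A : Set (DualGroup G)) : AddSubgroup G where
  carrier := {x | ∀ χ ∈ A, χ x = 0}
  zero_mem' χ _ := map_zero χ
  add_mem' {x y} hx hy χ hχ := by rw [map_add, hx χ hχ, hy χ hχ, add_zero]
  neg_mem' {x} hx χ hχ := by rw [map_neg, hx χ hχ, neg_zero]

theorem isClosed_dualCoannihilator (A : Set (DualGroup G)) :
    IsClosed (dualCoannihilator A : Set G) := by
  have : (dualCoannihilator A : Set G) = ⋂ χ ∈ A, χ ⁻¹' {0} := by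
    ext x
    simp [dualCoannihilator]
  rw [this]
  exact isClosed_biInter fun χ _ ↦ isClosed_singleton.preimage (map_continuous χ)

theorem dualCoannihilator_anti {A B : Set (DualGroup G)} (h : A ⊆ B) :
    dualCoannihilator B ≤ dualCoannihilator A :=
  fun _ hx χ hχ ↦ hx χ (h hχ)

theorem closure_le_dualAnnihilator_dualCoannihilator (A : Set (DualGroup G)) :
    AddSubgroup.closure A ≤ dualAnnihilator (dualCoannihilator A : Set G) :=
  (AddSubgroup.closure_le _).2 fun χ hχ _ hx ↦ hx χ hχ

variable [IsTopologicalAddGroup G] [CompactSpace G]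

theorem exists_mem_dualAnnihilator_apply_ne_zero {M : AddSubgroup G} (hM : IsClosed (M : Set G))
    {a : G} (ha : a ∉ M) : ∃ χ ∈ dualAnnihilator (M : Set G), χ a ≠ 0 := by
  have : IsClosed (M : Set G) := hM
  obtain ⟨χ, hχ⟩ := exists_dualGroup_apply_ne_zero (mt (QuotientAddGroup.eq_zero_iff a).1 ha)
  refine ⟨χ.comp ⟨QuotientAddGroup.mk' M, continuous_quotient_mk'⟩, fun x hx ↦ ?_, hχ⟩
  exact (congrArg χ ((QuotientAddGroup.eq_zero_iff x).2 hx)).trans (map_zero χ)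

theorem exists_finset_dualCoannihilator_subset [T2Space G] {U : Set G} (hU : U ∈ 𝓝 (0 : G)) :
    ∃ F : Finset (DualGroup G), (dualCoannihilator (F : Set (DualGroup G)) : Set G) ⊆ U := by
  have hker (χ : DualGroup G) : IsClosed (χ ⁻¹' {0}) :=
    isClosed_singleton.preimage (map_continuous χ)
  obtain ⟨F, hF⟩ := isOpen_interior.isClosed_compl.isCompact.elim_finite_subfamily_closed
    (fun χ : DualGroup G ↦ χ ⁻¹' {0}) hker (s := (interior U)ᶜ) (by
      by_contra! ⟨x, hxU, hx⟩
      have hx0 : x ≠ 0 := fun h ↦ hxU (h ▸ mem_interior_iff_mem_nhds.2 hU)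
      obtain ⟨χ, hχ⟩ := exists_dualGroup_apply_ne_zero hx0
      exact hχ (Set.mem_iInter.1 hx χ))
  refine ⟨F, fun x hx ↦ interior_subset (by_contra fun hxU ↦ ?_)⟩
  exact hF.subset ⟨hxU, Set.mem_iInter₂.2 hx⟩

end Annihilator

section ToComplex

variable {G : Type*} [AddCommGroup G] [TopologicalSpace G]

/-- Characters as complex-valued continuous functions; addition of characters becomes pointwise
multiplication of functions. -/
noncomputable def dualGroupToComplex : Multiplicative (DualGroup G) →* C(G, ℂ) where
  toFun χ := ⟨fun x ↦ (AddCircle.toCircle (χ.toAdd x) : ℂ),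
    continuous_subtype_val.comp (AddCircle.continuous_toCircle.comp (map_continuous χ.toAdd))⟩
  map_one' := by
    ext
    exact congrArg Subtype.val AddCircle.toCircle_zero
  map_mul' χ ψ := by
    ext x
    exact congrArg Subtype.val (AddCircle.toCircle_add _ _)

theorem dualGroupToComplex_apply (χ : DualGroup G) (x : G) :
    dualGroupToComplex (.ofAdd χ) x = AddCircle.toCircle (χ x) := rfl

theorem dualGroupToComplex_inv (χ : Multiplicative (DualGroup G)) :
    dualGroupToComplex χ⁻¹ = star (dualGroupToComplex χ) := by
  ext x
  exact (congrArg Subtype.val (AddCircle.toCircle_neg _)).trans (Circle.coe_inv_eq_conj _)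

theorem dualGroupToComplex_apply_eq_iff {χ : DualGroup G} {x y : G} :
    dualGroupToComplex (.ofAdd χ) x = dualGroupToComplex (.ofAdd χ) y ↔ χ x = χ y := by
  simp only [dualGroupToComplex_apply, Circle.coe_inj,
    (AddCircle.injective_toCircle (T := (1 : ℝ)) one_ne_zero).eq_iff]

open MeasureTheory in
theorem integral_dualGroupToComplex_eq_zero [IsTopologicalAddGroup G] [MeasurableSpace G]
    [BorelSpace G] (μ : Measure G) [μ.IsAddLeftInvariant] {χ : DualGroup G} (hχ : χ ≠ 0) :
    ∫ x, dualGroupToComplex (.ofAdd χ) x ∂μ = 0 := by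
  obtain ⟨a, ha⟩ := DFunLike.ne_iff.1 hχ
  have hmul (x : G) : dualGroupToComplex (.ofAdd χ) (a + x) =
      dualGroupToComplex (.ofAdd χ) a * dualGroupToComplex (.ofAdd χ) x := by
    simp only [dualGroupToComplex_apply, map_add, AddCircle.toCircle_add, Circle.coe_mul]
  have hinv := integral_add_left_eq_self (μ := μ) (fun x ↦ dualGroupToComplex (.ofAdd χ) x) a
  simp only [hmul, integral_const_mul] at hinv
  refine (mul_left_eq_self₀.1 hinv).resolve_left fun ha1 ↦ ha ?_
  have ha0 : dualGroupToComplex (.ofAdd χ) a = dualGroupToComplex (.ofAdd χ) 0 := by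
    rw [ha1, dualGroupToComplex_apply, map_zero, AddCircle.toCircle_zero, Circle.coe_one]
  exact (dualGroupToComplex_apply_eq_iff.1 ha0).trans (map_zero χ)

variable [CompactSpace G]

theorem topologicalClosure_span_dualGroupToComplex {B : AddSubgroup (DualGroup G)}
    (hB : dualCoannihilator (B : Set (DualGroup G)) = ⊥) :
    (Submodule.span ℂ (dualGroupToComplex ''
      (B.toSubgroup : Set (Multiplicative (DualGroup G))))).topologicalClosure = ⊤ := by
  let Φ : Subgroup (Multiplicative (DualGroup G)) := B.toSubgroup
  have hstar : star (dualGroupToComplex '' Φ) =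
      dualGroupToComplex '' (Φ : Set (Multiplicative (DualGroup G))) := by
    simp only [← Set.image_star, Set.image_image, ← dualGroupToComplex_inv]
    rw [← Set.image_image dualGroupToComplex, Set.image_inv_eq_inv, inv_coe_set]
  let A : StarSubalgebra ℂ C(G, ℂ) := StarAlgebra.adjoin ℂ (dualGroupToComplex '' Φ)
  have hspan : A.toSubalgebra.toSubmodule = Submodule.span ℂ (dualGroupToComplex '' Φ) := by
    rw [StarAlgebra.adjoin_toSubalgebra, hstar, Set.union_self, Algebra.adjoin_eq_span,
      ← Subgroup.coe_toSubmonoid, ← Submonoid.coe_map, Submonoid.closure_eq]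
  have hsep : A.SeparatesPoints := by
    intro x y hxy
    have hxyB : x - y ∉ dualCoannihilator (B : Set (DualGroup G)) := by
      rwa [hB, AddSubgroup.mem_bot, sub_eq_zero]
    obtain ⟨χ, hχB, hχ⟩ : ∃ χ ∈ B, χ (x - y) ≠ 0 := by
      contrapose! hxyB
      exact hxyB
    have hmem : dualGroupToComplex (.ofAdd χ) ∈ A :=
      StarAlgebra.subset_adjoin ℂ _ (Set.mem_image_of_mem _ hχB)
    refine ⟨_, ⟨_, hmem, rfl⟩, fun h ↦ hχ ?_⟩
    rw [map_sub, sub_eq_zero]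
    exact dualGroupToComplex_apply_eq_iff.1 h
  have hA := ContinuousMap.starSubalgebra_topologicalClosure_eq_top_of_separatesPoints A hsep
  rw [← hspan]
  exact SetLike.coe_injective
    (congrArg (fun S : StarSubalgebra ℂ C(G, ℂ) ↦ (S : Set C(G, ℂ))) hA)

open MeasureTheory in
theorem eq_top_of_dualCoannihilator_eq_bot [IsTopologicalAddGroup G] {B : AddSubgroup (DualGroup G)}
    (hB : dualCoannihilator (B : Set (DualGroup G)) = ⊥) : B = ⊤ := by
  let _ : MeasurableSpace G := borel G
  have _ : BorelSpace G := ⟨rfl⟩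
  let μ : Measure G := Measure.addHaarMeasure ⊤
  refine (AddSubgroup.eq_top_iff' B).2 fun χ ↦ by_contra fun hχ ↦ ?_
  let J : C(G, ℂ) →L[ℂ] Lp ℂ 2 μ := ContinuousMap.toLp 2 μ ℂ
  let L : C(G, ℂ) →L[ℂ] ℂ := (innerSL ℂ (J (dualGroupToComplex (.ofAdd χ)))).comp J
  have hL : Submodule.span ℂ (dualGroupToComplex ''
      (B.toSubgroup : Set (Multiplicative (DualGroup G)))) ≤ L.ker := by
    refine Submodule.span_le.2 ?_
    rintro _ ⟨ψ, hψ, rfl⟩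
    have hne : ψ.toAdd - χ ≠ 0 := fun h ↦ hχ (sub_eq_zero.1 h ▸ hψ)
    change inner ℂ (J _) (J _) = 0
    rw [ContinuousMap.inner_toLp, ← integral_dualGroupToComplex_eq_zero μ hne, ofAdd_sub,
      div_eq_mul_inv, map_mul, dualGroupToComplex_inv]
    rfl
  have hzero : L (dualGroupToComplex (.ofAdd χ)) = 0 := by
    have := Submodule.topologicalClosure_minimal _ hL L.isClosed_ker
    rw [topologicalClosure_span_dualGroupToComplex hB] at this
    exact this trivial
  have hJ : J (dualGroupToComplex (.ofAdd χ)) = 0 := inner_self_eq_zero.1 hzero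
  have hχ0 := ContinuousMap.toLp_injective μ (hJ.trans (map_zero J).symm)
  exact Circle.coe_ne_zero _ (DFunLike.congr_fun hχ0 0)

end ToComplex

section Bidual

variable {G : Type*} [AddCommGroup G] [TopologicalSpace G]

theorem exists_dualGroup_quotient_comp_mk_eq {N : AddSubgroup G} {χ : DualGroup G}
    (hχ : χ ∈ dualAnnihilator (N : Set G)) :
    ∃ ψ : DualGroup (G ⧸ N), ψ.comp ⟨QuotientAddGroup.mk' N, continuous_quotient_mk'⟩ = χ :=
  ⟨⟨QuotientAddGroup.lift N χ.toAddMonoidHom hχ, continuous_quot_lift _ (map_continuous χ)⟩, rfl⟩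

theorem dualAnnihilator_dualCoannihilator [IsTopologicalAddGroup G] [CompactSpace G]
    (A : Set (DualGroup G)) :
    dualAnnihilator (dualCoannihilator A : Set G) = AddSubgroup.closure A := by
  refine le_antisymm (fun χ hχ ↦ ?_) (closure_le_dualAnnihilator_dualCoannihilator A)
  let N := dualCoannihilator A
  let π : G →ₜ+ G ⧸ N := ⟨QuotientAddGroup.mk' N, continuous_quotient_mk'⟩
  let B : AddSubgroup (DualGroup (G ⧸ N)) :=
    (AddSubgroup.closure A).comap (ContinuousAddMonoidHom.compLeft UnitAddCircle π)
  have hB : dualCoannihilator (B : Set (DualGroup (G ⧸ N))) = ⊥ := by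
    refine (AddSubgroup.eq_bot_iff_forall _).2 fun y hy ↦ ?_
    obtain ⟨x, rfl⟩ := QuotientAddGroup.mk_surjective y
    refine (QuotientAddGroup.eq_zero_iff x).2 fun ψ hψA ↦ ?_
    have hψ := AddSubgroup.subset_closure hψA
    obtain ⟨φ, rfl⟩ := exists_dualGroup_quotient_comp_mk_eq
      (closure_le_dualAnnihilator_dualCoannihilator A hψ)
    exact hy φ hψ
  obtain ⟨φ, rfl⟩ := exists_dualGroup_quotient_comp_mk_eq hχ
  have hφB : φ ∈ B := eq_top_of_dualCoannihilator_eq_bot hB ▸ AddSubgroup.mem_top φ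
  exact hφB

end Bidual

/-! ### Weight -/

section Weight

open Cardinal

theorem exists_isTopologicalBasis_mk_eq_weight (X : Type u) [TopologicalSpace X] :
    ∃ B : Set (Set X), IsTopologicalBasis B ∧ #B = weight X :=
  csInf_mem (s := {κ : Cardinal.{u} | ∃ B : Set (Set X), IsTopologicalBasis B ∧ #B = κ})
    ⟨_, _, isTopologicalBasis_opens, rfl⟩

theorem weight_le_mk {X : Type u} [TopologicalSpace X] {B : Set (Set X)}
    (hB : IsTopologicalBasis B) : weight X ≤ #B :=
  csInf_le' ⟨B, hB, rfl⟩

theorem weight_le_weight_of_isInducing {X Y : Type u} [TopologicalSpace X] [TopologicalSpace Y]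
    {f : X → Y} (hf : IsInducing f) : weight X ≤ weight Y := by
  obtain ⟨B, hB, hBw⟩ := exists_isTopologicalBasis_mk_eq_weight Y
  exact hBw ▸ (weight_le_mk (hB.isInducing hf)).trans mk_image_le

theorem aleph0_le_weight (X : Type u) [TopologicalSpace X] [T1Space X] [PreconnectedSpace X]
    [Nontrivial X] : ℵ₀ ≤ weight X := by
  obtain ⟨B, hB, hBw⟩ := exists_isTopologicalBasis_mk_eq_weight X
  rw [← hBw]
  by_contra! hlt
  have hBfin : Finite B := lt_aleph0_iff_finite.1 hlt
  have hinj : Function.Injective fun x : X ↦ {b : B | x ∈ (b : Set X)} :=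
    fun x y hxy ↦ hB.eq_iff.2 fun s hs ↦ Set.ext_iff.1 hxy ⟨s, hs⟩
  have : Finite X := Finite.of_injective _ hinj
  exact not_subsingleton X PreconnectedSpace.trivial_of_discrete

theorem mk_setOf_finite_subset_le {X : Type u} {s : Set X} {κ : Cardinal.{u}} (hκ : ℵ₀ ≤ κ)
    (hs : #s ≤ κ) : #{t : Set X | t.Finite ∧ t ⊆ s} ≤ κ := by
  have hsub : {t : Set X | t.Finite ∧ t ⊆ s} ⊆
      Set.range fun t : Finset s ↦ Subtype.val '' (t : Set s) := by
    rintro t ⟨ht, hts⟩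
    exact ⟨(ht.preimage Subtype.val_injective.injOn).toFinset, by
      simpa [Set.inter_eq_left] using hts⟩
  refine (mk_le_mk_of_subset hsub).trans (mk_range_le.trans ?_)
  obtain hfin | hinf := finite_or_infinite s
  · exact mk_le_aleph0.trans hκ
  · exact (mk_finset_of_infinite s).trans_le hs

theorem weight_le_of_eq_generateFrom {X : Type u} [t : TopologicalSpace X] {s : Set (Set X)}
    (hs : t = generateFrom s) {κ : Cardinal.{u}} (hκ : ℵ₀ ≤ κ) (hsκ : #s ≤ κ) : weight X ≤ κ :=
  (weight_le_mk (isTopologicalBasis_of_subbasis hs)).trans <|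
    mk_image_le.trans (mk_setOf_finite_subset_le hκ hsκ)

theorem weight_le_of_separating {X : Type u} {Y : Type*} [TopologicalSpace X] [CompactSpace X]
    [TopologicalSpace Y] [T2Space Y] [SecondCountableTopology Y] {ι : Type u} {f : ι → X → Y}
    (hf : ∀ i, Continuous (f i)) (hsep : Function.Injective fun x i ↦ f i x)
    {κ : Cardinal.{u}} (hκ : ℵ₀ ≤ κ) (hι : #ι ≤ κ) : weight X ≤ κ := by
  have hF : IsInducing fun x i ↦ f i x :=
    ((continuous_pi hf).isClosedEmbedding hsep).isInducing
  have hgen : ‹TopologicalSpace X› =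
      generateFrom (⋃ i, Set.preimage (f i) '' countableBasis Y) := by
    simp only [hF.eq_induced, Pi.topologicalSpace, induced_iInf, generateFrom_iUnion,
      induced_compose, ← induced_generateFrom_eq, ← (isBasis_countableBasis Y).eq_generateFrom]
    rfl
  refine weight_le_of_eq_generateFrom hgen hκ ?_
  refine (mk_iUnion_le _).trans (mul_le_of_le hκ hι (ciSup_le' fun i ↦ ?_))
  exact ((countable_countableBasis Y).image _).le_aleph0.trans hκ

theorem mk_addSubgroup_closure_le {X : Type u} [AddGroup X] {A : Set X} {κ : Cardinal.{u}}
    (hκ : ℵ₀ ≤ κ) (hA : #A ≤ κ) : #(AddSubgroup.closure A) ≤ κ := by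
  obtain rfl | hne := A.eq_empty_or_nonempty
  · rw [AddSubgroup.closure_empty, mk_eq_one]
    exact one_le_aleph0.trans hκ
  · have : Nonempty A := hne.to_subtype
    rw [FreeAddGroup.closure_eq_range]
    exact mk_range_le.trans ((mk_freeAddGroup A).trans_le (max_le hA hκ))

end Weight

/-! ### Torsion characters and connectedness -/

section Torsion

open Cardinal

theorem dualGroup_apply_eq_zero_of_isPreconnected {G : Type*} [AddCommGroup G] [TopologicalSpace G]
    {t : Set G} (ht : IsPreconnected t) (h0 : 0 ∈ t) (χ : DualGroup G) {n : ℕ} (hn : 0 < n)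
    (h : ∀ x ∈ t, n • χ x = 0) {x : G} (hx : x ∈ t) : χ x = 0 := by
  have hconn : IsPreconnected (χ '' t) := ht.image _ (map_continuous χ).continuousOn
  have hfin : (χ '' t).Finite := (AddCircle.finite_torsion 1 hn).subset (Set.image_subset_iff.2 h)
  by_contra hne
  exact hconn.infinite_of_nontrivial ⟨χ x, ⟨x, hx, rfl⟩, 0, ⟨0, h0, map_zero χ⟩, hne⟩ hfin

instance isAddTorsionFree_dualGroup {C : Type*} [AddCommGroup C] [TopologicalSpace C]
    [PreconnectedSpace C] : IsAddTorsionFree (DualGroup C) where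
  nsmul_right_injective n hn χ ψ h := by
    refine ContinuousAddMonoidHom.ext fun x ↦ sub_eq_zero.1 ?_
    refine dualGroup_apply_eq_zero_of_isPreconnected isPreconnected_univ (Set.mem_univ 0) (χ - ψ)
      (Nat.pos_of_ne_zero hn) (fun y _ ↦ (smul_sub n (χ y) (ψ y)).trans ?_) (Set.mem_univ x)
    rw [sub_eq_zero, ← ContinuousAddMonoidHom.nsmul_apply, ← ContinuousAddMonoidHom.nsmul_apply]
    exact DFunLike.congr_fun h y

theorem exists_isOpen_forall_addSubgroup_subset_apply_eq_zero {G : Type*} [AddCommGroup G]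
    [TopologicalSpace G] (χ : DualGroup G) : ∃ U : Set G, IsOpen U ∧ 0 ∈ U ∧
      ∀ H : AddSubgroup G, (H : Set G) ⊆ U → ∀ x ∈ H, χ x = 0 := by
  refine ⟨{x | AddCircle.toCircle (χ x) ∈ Circle.centeredArc (Real.pi / 2)},
    (Circle.isOpen_centeredArc _).preimage
      (AddCircle.continuous_toCircle.comp (map_continuous χ)), ?_, fun H hH x hx ↦ ?_⟩
  · simp only [Set.mem_ofPred_eq, map_zero, AddCircle.toCircle_zero]
    exact ⟨0, by simp [Real.pi_pos], by simp⟩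
  · refine AddCircle.injective_toCircle one_ne_zero (.trans ?_ AddCircle.toCircle_zero.symm)
    refine Circle.eq_one_of_forall_pow_mem_centeredArc_pi_div_two fun n _ ↦ ?_
    rw [← AddCircle.toCircle_nsmul, ← map_nsmul]
    exact hH (H.nsmul_mem hx n)

theorem exists_nsmul_eq_zero_of_totallyDisconnectedSpace {Q : Type*} [AddCommGroup Q]
    [TopologicalSpace Q] [IsTopologicalAddGroup Q] [CompactSpace Q]
    [TotallyDisconnectedSpace Q] (χ : DualGroup Q) : ∃ n : ℕ, 0 < n ∧ n • χ = 0 := by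
  obtain ⟨U, hU, h0, hχ⟩ := exists_isOpen_forall_addSubgroup_subset_apply_eq_zero χ
  obtain ⟨H, hH⟩ := ProfiniteGrp.exist_openNormalAddSubgroup_sub_open_nhds_of_zero hU h0
  have hfin : Finite (Q ⧸ H.toAddSubgroup) := AddSubgroup.quotient_finite_of_isOpen _ H.isOpen
  have : H.toAddSubgroup.FiniteIndex := AddSubgroup.finiteIndex_of_finite_quotient
  refine ⟨H.toAddSubgroup.index, Nat.pos_of_ne_zero AddSubgroup.FiniteIndex.index_ne_zero,
    ContinuousAddMonoidHom.ext fun x ↦ ?_⟩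
  rw [ContinuousAddMonoidHom.nsmul_apply, ← map_nsmul]
  exact hχ _ hH _ (H.toAddSubgroup.nsmul_index_mem x)

theorem exists_nsmul_mem_closure_of_isTotallyDisconnected {G : Type*} [AddCommGroup G]
    [TopologicalSpace G] [IsTopologicalAddGroup G] [CompactSpace G]
    {A : Set (DualGroup G)} (hA : IsTotallyDisconnected (dualCoannihilator A : Set G))
    (χ : DualGroup G) : ∃ n : ℕ, 0 < n ∧ n • χ ∈ AddSubgroup.closure A := by
  let Q := dualCoannihilator A
  have : CompactSpace Q := isCompact_iff_compactSpace.1 (isClosed_dualCoannihilator A).isCompact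
  have : TotallyDisconnectedSpace Q := totallyDisconnectedSpace_subtype_iff.2 hA
  obtain ⟨n, hn, h⟩ := exists_nsmul_eq_zero_of_totallyDisconnectedSpace
    (χ.comp ⟨Q.subtype, continuous_subtype_val⟩)
  rw [← dualAnnihilator_dualCoannihilator]
  refine ⟨n, hn, fun x hx ↦ ?_⟩
  have hx0 := DFunLike.congr_fun h ⟨x, hx⟩
  rw [ContinuousAddMonoidHom.nsmul_apply] at hx0 ⊢
  exact hx0

theorem mk_le_of_forall_exists_nsmul_mem_closure {X : Type u} [AddCommGroup X]
    [IsAddTorsionFree X] {A : Set X} {κ : Cardinal.{u}} (hκ : ℵ₀ ≤ κ) (hAκ : #A ≤ κ)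
    (hA : ∀ x : X, ∃ n : ℕ, 0 < n ∧ n • x ∈ AddSubgroup.closure A) : #X ≤ κ := by
  choose n hn hmem using hA
  have hinj : Function.Injective fun x : X ↦
      ((⟨n x⟩, ⟨n x • x, hmem x⟩) : ULift.{u} ℕ × AddSubgroup.closure A) := by
    intro x y hxy
    simp only [Prod.mk.injEq, ULift.up.injEq, Subtype.mk.injEq] at hxy
    obtain ⟨hnxy, hsmul⟩ := hxy
    exact nsmul_right_injective (hn x).ne' (hsmul.trans (by rw [hnxy]))
  refine (mk_le_of_injective hinj).trans ?_
  rw [mk_prod, lift_id, lift_id]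
  exact mul_le_of_le hκ (mk_le_aleph0.trans hκ) (mk_addSubgroup_closure_le hκ hAκ)

theorem weight_le_of_mk_dualGroup_le {G : Type u} [AddCommGroup G] [TopologicalSpace G]
    [IsTopologicalAddGroup G] [T2Space G] [CompactSpace G] {κ : Cardinal.{u}} (hκ : ℵ₀ ≤ κ)
    (hG : #(DualGroup G) ≤ κ) : weight G ≤ κ := by
  refine weight_le_of_separating (f := fun χ : DualGroup G ↦ χ) map_continuous (fun x y h ↦ ?_)
    hκ hG
  by_contra hne
  obtain ⟨χ, hχ⟩ := exists_dualGroup_apply_ne_zero (sub_ne_zero.2 hne)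
  exact hχ ((map_sub χ x y).trans (sub_eq_zero.2 (congrFun h χ)))

theorem weight_le_of_isTotallyDisconnected_dualCoannihilator {C : Type u} [AddCommGroup C]
    [TopologicalSpace C] [IsTopologicalAddGroup C] [T2Space C] [CompactSpace C]
    [PreconnectedSpace C] {A : Set (DualGroup C)}
    (hA : IsTotallyDisconnected (dualCoannihilator A : Set C)) {κ : Cardinal.{u}} (hκ : ℵ₀ ≤ κ)
    (hAκ : #A ≤ κ) : weight C ≤ κ :=
  weight_le_of_mk_dualGroup_le hκ <| mk_le_of_forall_exists_nsmul_mem_closure hκ hAκ <|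
    exists_nsmul_mem_closure_of_isTotallyDisconnected hA

theorem isTotallyDisconnected_of_forall_isPreconnected_zero_mem {G : Type*} [AddGroup G]
    [TopologicalSpace G] [ContinuousAdd G] {P : AddSubgroup G}
    (h : ∀ t : Set G, IsPreconnected t → 0 ∈ t → t ⊆ P → t ⊆ {0}) :
    IsTotallyDisconnected (P : Set G) := by
  intro t htP ht x hx y hy
  have := h ((· + -x) '' t) (ht.image _ (by fun_prop)) ⟨x, hx, add_neg_cancel x⟩
    (Set.image_subset_iff.2 fun z hz ↦ P.add_mem (htP hz) (P.neg_mem (htP hx))) ⟨y, hy, rfl⟩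
  exact (eq_of_sub_eq_zero (sub_eq_add_neg y x ▸ this)).symm

end Torsion

/-! ### Covering dimension -/

section CoveringDimension

open Function

theorem exists_pairwise_disjoint_isOpen_refinement {X : Type*} [TopologicalSpace X] [T2Space X]
    {F : Set X} (hF : IsCompact F) (hFd : IsTotallyDisconnected F) {U : Set (Set X)}
    (hU : ∀ u ∈ U, IsOpen u) (hFU : F ⊆ ⋃₀ U) :
    ∃ (n : ℕ) (W : Fin n → Set X), (∀ j, IsOpen (W j)) ∧ (∀ j, ∃ u ∈ U, W j ⊆ u) ∧
      Pairwise (Disjoint on W) ∧ F ⊆ ⋃ j, W j := by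
  have : CompactSpace F := isCompact_iff_compactSpace.1 hF
  have : TotallyDisconnectedSpace F := totallyDisconnectedSpace_subtype_iff.2 hFd
  have hopen (u : U) : IsOpen (Subtype.val ⁻¹' u.1 : Set F) :=
    (hU u.1 u.2).preimage continuous_subtype_val
  have hcover : ⋃ u : U, (Subtype.val ⁻¹' u.1 : Set F) = Set.univ := by
    rwa [← Set.preimage_iUnion, ← Set.sUnion_eq_iUnion, ← Set.univ_subset_iff,
      ← Set.image_subset_iff, Subtype.coe_image_univ]
  obtain ⟨n, D, hDU, hDF, hDd⟩ :=
    (IsOpenCover.of_sets hopen hcover).exists_finite_nonempty_disjoint_clopen_cover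
  choose u hDu using fun j ↦ (hDU j).2
  have hcompact (j : Fin n) : IsCompact (Subtype.val '' (D j : Set F)) :=
    (D j).isClopen.1.isCompact.image continuous_subtype_val
  have hnhds : Pairwise (Disjoint on fun j ↦ 𝓝ˢ (Subtype.val '' (D j : Set F))) := by
    intro i j hij
    refine separatedNhds_iff_disjoint.1 (.of_isCompact_isCompact (hcompact i) (hcompact j) ?_)
    exact (Set.disjoint_image_iff Subtype.val_injective).2 (Clopens.coe_disjoint.2 (hDd hij))
  obtain ⟨O, hO, hOd⟩ := hnhds.exists_mem_filter_basis_of_disjoint fun _ ↦ hasBasis_nhdsSet _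
  refine ⟨n, fun j ↦ O j ∩ u j, fun j ↦ (hO j).1.inter (hU _ (u j).2),
    fun j ↦ ⟨u j, (u j).2, Set.inter_subset_right⟩,
    fun i j hij ↦ (hOd hij).mono Set.inter_subset_left Set.inter_subset_left, fun x hx ↦ ?_⟩
  obtain ⟨j, hj⟩ := Set.mem_iUnion.1 (hDF (Set.mem_univ ⟨x, hx⟩))
  exact Set.mem_iUnion.2 ⟨j, (hO j).2 ⟨_, hj, rfl⟩, hDu j hj⟩

theorem exists_isOpen_preimage_subset_of_isClosedMap {X Y : Type*} [TopologicalSpace X]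
    [TopologicalSpace Y] {f : X → Y} (hf : IsClosedMap f) {O : Set X} (hO : IsOpen O) {y : Y}
    (hy : f ⁻¹' {y} ⊆ O) : ∃ N : Set Y, IsOpen N ∧ y ∈ N ∧ f ⁻¹' N ⊆ O := by
  refine ⟨(f '' Oᶜ)ᶜ, (hf _ hO.isClosed_compl).isOpen_compl, ?_, ?_⟩
  · rintro ⟨x, hx, rfl⟩
    exact hx (hy rfl)
  · exact fun x hx ↦ by_contra fun hxO ↦ hx ⟨x, hxO, rfl⟩

theorem hasCoveringDimensionLT_of_isTotallyDisconnected_fiber {X Y : Type u} [TopologicalSpace X]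
    [TopologicalSpace Y] [CompactSpace X] [T2Space X] [CompactSpace Y] [T2Space Y] {f : X → Y}
    (hf : Continuous f) (hfib : ∀ y, IsTotallyDisconnected (f ⁻¹' {y})) {n : ℕ}
    (hY : HasCoveringDimensionLT Y n) : HasCoveringDimensionLT X n := by
  intro U _ hU hUX
  choose m W hW hWU hWd hWf using fun y ↦ exists_pairwise_disjoint_isOpen_refinement
    (isClosed_singleton.preimage hf).isCompact (hfib y) hU (hUX ▸ Set.subset_univ _)
  choose N hN hyN hNW using fun y ↦
    exists_isOpen_preimage_subset_of_isClosedMap hf.isClosedMap (isOpen_iUnion (hW y)) (hWf y)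
  obtain ⟨t, ht⟩ := isCompact_univ.elim_finite_subcover N hN fun y _ ↦ Set.mem_iUnion.2 ⟨y, hyN y⟩
  obtain ⟨V, hVfin, hV, hVY, hVN, hVn⟩ := hY (N '' t) (t.finite_toSet.image N)
    (Set.forall_mem_image.2 fun y _ ↦ hN y)
    (by rwa [Set.sUnion_image, ← Set.univ_subset_iff])
  have hVN' (v : V) : ∃ y, v.1 ⊆ N y := by
    obtain ⟨_, ⟨y, -, rfl⟩, hvy⟩ := hVN v v.2
    exact ⟨y, hvy⟩
  choose y hy using hVN'
  have : Finite V := hVfin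
  let P (p : Σ v : V, Fin (m (y v))) : Set X := f ⁻¹' p.1 ∩ W _ p.2
  refine ⟨Set.range P, Set.finite_range P, ?_, ?_, ?_, fun x ↦ ?_⟩
  · exact Set.forall_mem_range.2 fun p ↦ ((hV _ p.1.2).preimage hf).inter (hW _ _)
  · refine Set.eq_univ_of_forall fun x ↦ ?_
    obtain ⟨v, hv, hxv⟩ := hVY.symm ▸ Set.mem_univ (f x)
    obtain ⟨j, hj⟩ := Set.mem_iUnion.1 (hNW _ (hy ⟨v, hv⟩ hxv))
    exact ⟨_, ⟨⟨⟨v, hv⟩, j⟩, rfl⟩, hxv, hj⟩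
  · refine Set.forall_mem_range.2 fun p ↦ ?_
    obtain ⟨u, hu, hWu⟩ := hWU _ p.2
    exact ⟨u, hu, Set.inter_subset_right.trans hWu⟩
  · have hsub : {s ∈ Set.range P | x ∈ s} ⊆ P '' {p | x ∈ P p} := by
      rintro _ ⟨⟨p, rfl⟩, hp⟩
      exact ⟨p, hp, rfl⟩
    have hmaps : Set.MapsTo (fun p ↦ p.1.1) {p | x ∈ P p} {v ∈ V | f x ∈ v} :=
      fun p hp ↦ ⟨p.1.2, hp.1⟩
    have hinj : Set.InjOn (fun p ↦ p.1.1) {p | x ∈ P p} := by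
      rintro ⟨v, i⟩ hi ⟨v', j⟩ hj hvv'
      obtain rfl : v = v' := Subtype.ext hvv'
      obtain rfl : i = j := by_contra fun hij ↦ Set.disjoint_left.1 (hWd _ hij) hi.2 hj.2
      rfl
    exact (Set.encard_le_encard hsub).trans <| (Set.encard_image_le P _).trans <|
      (Set.encard_le_encard_of_injOn hmaps hinj).trans (hVn (f x))

theorem coveringDimension_ne_top {X : Type u} [TopologicalSpace X] {n : ℕ}
    (h : HasCoveringDimensionLT X n) : coveringDimension X ≠ ⊤ := by
  have hle : coveringDimension X ≤ ((n : ℕ∞) : WithBot ℕ∞) := by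
    refine sInf_le fun m hnm U hUfin hU hUX ↦ ?_
    obtain ⟨V, hVfin, hV, hVX, hVU, hVn⟩ := h U hUfin hU hUX
    exact ⟨V, hVfin, hV, hVX, hVU, fun x ↦ (hVn x).trans (by exact_mod_cast hnm.le)⟩
  exact (hle.trans_lt (WithBot.coe_lt_coe.2 (ENat.natCast_lt_top n))).ne

/-- The open sup-norm ball of radius `ε` around the point of the lattice `ε ℤ^ι` with
coordinates `k`; these balls cover the space with multiplicity at most `2 ^ #ι`. -/
def latticeBall {ι : Type*} [Fintype ι] (ε : ℝ) (k : ι → ℤ) : Set (ι → ℝ) :=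
  Metric.ball (fun i ↦ ε * k i) ε

theorem mem_latticeBall_iff {ι : Type*} [Fintype ι] {ε : ℝ} (hε : 0 < ε) {k : ι → ℤ}
    {x : ι → ℝ} : x ∈ latticeBall ε k ↔ ∀ i, |x i / ε - k i| < 1 := by
  rw [latticeBall, Metric.mem_ball, dist_pi_lt_iff hε]
  refine forall_congr' fun i ↦ ?_
  have : x i - ε * k i = (x i / ε - k i) * ε := by field_simp
  rw [Real.dist_eq, this, abs_mul, abs_of_pos hε, mul_lt_iff_lt_one_left hε]

theorem mem_latticeBall_floor {ι : Type*} [Fintype ι] {ε : ℝ} (hε : 0 < ε) (x : ι → ℝ) :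
    x ∈ latticeBall ε fun i ↦ ⌊x i / ε⌋ := by
  refine (mem_latticeBall_iff hε).2 fun i ↦ ?_
  rw [Int.self_sub_floor, Int.abs_fract]
  exact Int.fract_lt_one _

theorem encard_setOf_mem_latticeBall_le {ι : Type*} [Fintype ι] {ε : ℝ} (hε : 0 < ε)
    (x : ι → ℝ) : {k | x ∈ latticeBall ε k}.encard ≤ (2 ^ Fintype.card ι : ℕ) := by
  classical
  let F : Finset (ι → ℤ) := Fintype.piFinset fun i ↦ {⌊x i / ε⌋, ⌊x i / ε⌋ + 1}
  have hsub : {k | x ∈ latticeBall ε k} ⊆ (F : Set (ι → ℤ)) := by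
    refine fun k hk ↦ Finset.mem_coe.2 (Fintype.mem_piFinset.2 fun i ↦ ?_)
    obtain ⟨hlt, hgt⟩ := abs_sub_lt_iff.1 ((mem_latticeBall_iff hε).1 hk i)
    have hfloor : ⌊x i / ε⌋ < k i + 1 := Int.floor_lt.2 (by push_cast; linarith)
    have hceil : k i - 1 ≤ ⌊x i / ε⌋ := Int.le_floor.2 (by push_cast; linarith)
    rw [Finset.mem_insert, Finset.mem_singleton]
    lia
  refine (Set.encard_le_encard hsub).trans ?_
  rw [Set.encard_coe_eq_coe_finsetCard, Nat.cast_le, Fintype.card_piFinset, ← Finset.card_univ]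
  exact Finset.prod_le_pow_card _ _ 2 fun i _ ↦ Finset.card_le_two

theorem hasCoveringDimensionLT_of_isCompact {ι : Type u} [Fintype ι] {s : Set (ι → ℝ)}
    (hs : IsCompact s) : HasCoveringDimensionLT s (2 ^ Fintype.card ι) := by
  intro U _ hU hUs
  have : CompactSpace s := isCompact_iff_compactSpace.1 hs
  obtain ⟨δ, hδ, hδU⟩ := lebesgue_number_lemma_of_metric_sUnion isCompact_univ hU hUs.ge
  obtain ⟨ε, hε, rfl⟩ : ∃ ε > 0, 2 * ε = δ := ⟨δ / 2, by positivity, by ring⟩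
  let B (k : ι → ℤ) : Set s := Subtype.val ⁻¹' latticeBall ε k
  let k (x : s) (i : ι) : ℤ := ⌊x.1 i / ε⌋
  have hk (x : s) : x ∈ B (k x) := mem_latticeBall_floor hε x.1
  have hB (x : s) : IsOpen (B (k x)) := Metric.isOpen_ball.preimage continuous_subtype_val
  obtain ⟨t, ht⟩ := isCompact_univ.elim_finite_subcover (fun x ↦ B (k x)) hB fun x _ ↦
    Set.mem_iUnion.2 ⟨x, hk x⟩
  refine ⟨(fun x ↦ B (k x)) '' t, t.finite_toSet.image _, Set.forall_mem_image.2 fun x _ ↦ hB x,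
    by rwa [Set.sUnion_image, ← Set.univ_subset_iff], Set.forall_mem_image.2 fun x _ ↦ ?_,
    fun x ↦ ?_⟩
  · obtain ⟨u, hu, hxu⟩ := hδU x (Set.mem_univ x)
    refine ⟨u, hu, fun y hy ↦ hxu ?_⟩
    have := dist_triangle_right y.1 x.1 (fun i ↦ ε * k x i)
    have hyk : dist y.1 (fun i ↦ ε * k x i) < ε := hy
    have hxk : dist x.1 (fun i ↦ ε * k x i) < ε := hk x
    rw [Metric.mem_ball, Subtype.dist_eq]
    linarith
  · have hsub : {b ∈ (fun x ↦ B (k x)) '' t | x ∈ b} ⊆ B '' {k | x.1 ∈ latticeBall ε k} := by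
      rintro _ ⟨⟨y, -, rfl⟩, hy⟩
      exact ⟨k y, hy, rfl⟩
    exact (Set.encard_le_encard hsub).trans <| (Set.encard_image_le B _).trans <|
      encard_setOf_mem_latticeBall_le hε x.1

end CoveringDimension

section GroupDimension

theorem hasCoveringDimensionLT_of_isTotallyDisconnected_dualCoannihilator {G : Type u}
    [AddCommGroup G] [TopologicalSpace G] [IsTopologicalAddGroup G] [CompactSpace G] [T2Space G]
    {S : Finset (DualGroup G)}
    (hS : IsTotallyDisconnected (dualCoannihilator (S : Set (DualGroup G)) : Set G)) :
    HasCoveringDimensionLT G (2 ^ Fintype.card (S ⊕ S)) := by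
  let f (x : G) : S ⊕ S → ℝ :=
    Sum.elim (fun χ ↦ (dualGroupToComplex (.ofAdd χ.1) x).re)
      fun χ ↦ (dualGroupToComplex (.ofAdd χ.1) x).im
  have hf : Continuous f := by
    refine continuous_pi ?_
    rintro (χ | χ)
    · exact Complex.continuous_re.comp (map_continuous (dualGroupToComplex (.ofAdd χ.1)))
    · exact Complex.continuous_im.comp (map_continuous (dualGroupToComplex (.ofAdd χ.1)))
  have hsub (x y : G) (hxy : f x = f y) : x - y ∈ dualCoannihilator (S : Set (DualGroup G)) := by
    refine fun χ hχ ↦ (map_sub χ x y).trans (sub_eq_zero.2 ?_)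
    exact dualGroupToComplex_apply_eq_iff.1 <|
      Complex.ext (congrFun hxy (.inl ⟨χ, hχ⟩)) (congrFun hxy (.inr ⟨χ, hχ⟩))
  have hrange : IsCompact (Set.range f) := isCompact_range hf
  have : CompactSpace (Set.range f) := isCompact_iff_compactSpace.1 hrange
  refine hasCoveringDimensionLT_of_isTotallyDisconnected_fiber hf.rangeFactorization
    (fun y t hty ht x hx z hz ↦ ?_) (hasCoveringDimensionLT_of_isCompact hrange)
  have hty' : (· - x) '' t ⊆ dualCoannihilator (S : Set (DualGroup G)) :=
    Set.image_subset_iff.2 fun w hw ↦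
      hsub w x (congrArg Subtype.val ((hty hw).trans (hty hx).symm))
  have hxz := hS _ hty' (ht.image _ (by fun_prop)) ⟨x, hx, rfl⟩ ⟨z, hz, rfl⟩
  exact sub_left_injective hxz

end GroupDimension

/-! ### Subgroups of finite rank -/

section Rank

variable {ι X : Type*} [AddCommGroup X]

theorem exists_addMonoidHom_forall_apply_eq_of_linearIndependent {D : Type*} [AddCommGroup D]
    [DivisibleBy D ℤ] {v : ι → X} (hv : LinearIndependent ℤ v) (h : ι → D) :
    ∃ g : X →+ D, ∀ i, g (v i) = h i := by
  obtain ⟨g, hg⟩ := (Module.Baer.of_divisible D).extension_property_addMonoidHom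
    (Finsupp.linearCombination ℤ v).toAddMonoidHom hv
    (Finsupp.linearCombination ℤ h).toAddMonoidHom
  exact ⟨g, fun i ↦ by simpa using! DFunLike.congr_fun hg (Finsupp.single i 1)⟩

theorem exists_addMonoidHom_rat_comp_surjective [Infinite ι] {v : ι → X}
    (hv : LinearIndependent ℤ v) : ∃ g : X →+ ℚ, Function.Surjective (g ∘ v) := by
  obtain ⟨r, hr⟩ := exists_surjective_nat ℚ
  obtain ⟨g, hg⟩ := exists_addMonoidHom_forall_apply_eq_of_linearIndependent hv
    (r ∘ Function.invFun (Infinite.natEmbedding ι))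
  refine ⟨g, ?_⟩
  rw [show g ∘ v = r ∘ Function.invFun (Infinite.natEmbedding ι) from funext hg]
  exact hr.comp (Function.invFun_surjective (Infinite.natEmbedding ι).injective)

theorem exists_linearIndepOn_forall_nsmul_mem_closure (v : ι → X) :
    ∃ I : Set ι, LinearIndepOn ℤ v I ∧
      ∀ i, ∃ n : ℕ, 0 < n ∧ n • v i ∈ AddSubgroup.closure (v '' I) := by
  obtain ⟨I, hI, hmax⟩ := exists_maximal_linearIndepOn ℤ v
  refine ⟨I, hI, fun i ↦ ?_⟩
  by_cases hi : i ∈ I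
  · exact ⟨1, one_pos, (one_nsmul (v i)).symm ▸ AddSubgroup.subset_closure ⟨i, hi, rfl⟩⟩
  · obtain ⟨a, ha, hspan⟩ := hmax i hi
    rw [← Submodule.mem_toAddSubgroup, Submodule.span_int_eq_addSubgroupClosure] at hspan
    obtain ⟨n, rfl | rfl⟩ := a.eq_nat_or_neg
    · exact ⟨n, by lia, by simpa using hspan⟩
    · exact ⟨n, by lia, by simpa using hspan⟩

theorem exists_finset_forall_nsmul_mem_closure {Y : AddSubgroup X} {F : Finset X}
    (hF : ∀ B : AddSubgroup X, (F : Set X) ⊆ B → Y ⊔ B = ⊤ → B = ⊤) :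
    ∃ S : Finset X, ∀ y ∈ Y, ∃ n : ℕ, 0 < n ∧ n • y ∈ AddSubgroup.closure (S : Set X) := by
  classical
  let π : X →+ X ⧸ AddSubgroup.closure (F : Set X) := QuotientAddGroup.mk' _
  obtain ⟨I, hI, hIY⟩ := exists_linearIndepOn_forall_nsmul_mem_closure fun y : Y ↦ π y
  obtain hfin | hinf := I.finite_or_infinite
  · let S : Finset X := hfin.toFinset.image Subtype.val
    have hS : (fun y : Y ↦ π y) '' I = π '' S := by
      simp [S, Set.image_image]
    refine ⟨F ∪ S, fun y hy ↦ ?_⟩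
    obtain ⟨n, hn, hmem⟩ := hIY ⟨y, hy⟩
    rw [hS, ← AddMonoidHom.map_closure] at hmem
    obtain ⟨s, hs, hsy⟩ := hmem
    have hdiff : -s + n • y ∈ AddSubgroup.closure (F : Set X) :=
      QuotientAddGroup.eq.1 (hsy.trans (map_nsmul π n y).symm)
    refine ⟨n, hn, ?_⟩
    rw [Finset.coe_union, AddSubgroup.closure_union, ← add_neg_cancel_left s (n • y)]
    exact add_mem (AddSubgroup.mem_sup_right hs) (AddSubgroup.mem_sup_left hdiff)
  · have : Infinite I := hinf.to_subtype
    obtain ⟨g, hg⟩ := exists_addMonoidHom_rat_comp_surjective hI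
    have hFker : (F : Set X) ⊆ (g.comp π).ker := fun x hx ↦ by
      have hx0 : π x = 0 := (QuotientAddGroup.eq_zero_iff x).2 (AddSubgroup.subset_closure hx)
      exact (congrArg g hx0).trans (map_zero g)
    have hsup : Y ⊔ (g.comp π).ker = ⊤ := by
      refine (AddSubgroup.eq_top_iff' _).2 fun x ↦ ?_
      obtain ⟨y, hy⟩ := hg (g (π x))
      refine AddSubgroup.mem_sup.2 ⟨y.1, y.1.2, x - y.1, ?_, add_sub_cancel _ _⟩
      exact (map_sub (g.comp π) _ _).trans (sub_eq_zero.2 hy.symm)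
    obtain ⟨y, hy⟩ := hg 1
    have hy0 : g (π y) = 0 :=
      AddMonoidHom.mem_ker.1 (hF _ hFker hsup ▸ AddSubgroup.mem_top y.1.1 : y.1.1 ∈ (g.comp π).ker)
    exact (one_ne_zero (hy.symm.trans hy0)).elim

end Rank

/-! ### Weight of the connected component -/

section ConnectedComponent

open Cardinal

variable {K : Type u} [AddCommGroup K] [TopologicalSpace K] [IsTopologicalAddGroup K]

instance connectedSpace_connectedComponentOfZero :
    ConnectedSpace (AddSubgroup.connectedComponentOfZero K) :=
  isConnected_iff_connectedSpace.1 (isConnected_connectedComponent (x := (0 : K)))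

theorem isInducing_coe_coe_connectedComponentOfZero (M : AddSubgroup K) :
    IsInducing fun y : AddSubgroup.connectedComponentOfZero M ↦ ((y : M) : K) :=
  IsInducing.subtypeVal.comp IsInducing.subtypeVal

theorem weight_connectedComponentOfZero_mono (M : AddSubgroup K) :
    weight (AddSubgroup.connectedComponentOfZero M) ≤
      weight (AddSubgroup.connectedComponentOfZero K) := by
  have hM := isInducing_coe_coe_connectedComponentOfZero M
  have hMK (y : AddSubgroup.connectedComponentOfZero M) :
      ((y : M) : K) ∈ AddSubgroup.connectedComponentOfZero K :=
    continuous_subtype_val.image_connectedComponent_subset (0 : M) ⟨y, y.2, rfl⟩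
  exact weight_le_weight_of_isInducing (hM.codRestrict hMK)

theorem exists_mem_connectedComponentOfZero_coe_coe_eq {M : AddSubgroup K} {t : Set K}
    (ht : IsPreconnected t) (h0 : 0 ∈ t) (htM : t ⊆ M) {x : K} (hx : x ∈ t) :
    ∃ y : AddSubgroup.connectedComponentOfZero M, ((y : M) : K) = x := by
  have htM' : (Subtype.val : M → K) '' (Subtype.val ⁻¹' t) = t :=
    Set.image_preimage_eq_of_subset (htM.trans_eq Subtype.range_coe.symm)
  have hpre : IsPreconnected ((Subtype.val : M → K) ⁻¹' t) :=
    IsInducing.subtypeVal.isPreconnected_image.1 (htM'.symm ▸ ht)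
  exact ⟨⟨⟨x, htM hx⟩, hpre.subset_connectedComponent (x := 0) h0 hx⟩, rfl⟩

variable [T2Space K] [CompactSpace K]

theorem weight_connectedComponentOfZero_le {A : Set (DualGroup K)}
    (hA : IsTotallyDisconnected (dualCoannihilator A : Set K)) {κ : Cardinal.{u}} (hκ : ℵ₀ ≤ κ)
    (hAκ : #A ≤ κ) : weight (AddSubgroup.connectedComponentOfZero K) ≤ κ := by
  let C := AddSubgroup.connectedComponentOfZero K
  have : CompactSpace C := isCompact_iff_compactSpace.1 isClosed_connectedComponent.isCompact
  let restrict (χ : DualGroup K) : DualGroup C := χ.comp ⟨C.subtype, continuous_subtype_val⟩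
  refine weight_le_of_isTotallyDisconnected_dualCoannihilator (A := restrict '' A)
    (fun t htA ht ↦ ?_) hκ (mk_image_le.trans hAκ)
  refine Set.subsingleton_of_image Subtype.val_injective t (hA _ ?_ ?_)
  · rintro _ ⟨x, hx, rfl⟩ χ hχ
    exact htA hx _ ⟨χ, hχ, rfl⟩
  · exact ht.image _ continuous_subtype_val.continuousOn

theorem exists_mk_le_weight_forall_mem_dualCoannihilator_eq {H : Type u} [TopologicalSpace H]
    [T1Space H] {f : H → K} (hf : IsInducing f) {o : H} (ho : f o = 0) (hw : ℵ₀ ≤ weight H) :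
    ∃ A : Set (DualGroup K), #A ≤ weight H ∧ ∀ x, f x ∈ dualCoannihilator A → x = o := by
  obtain ⟨B, hB, hBw⟩ := exists_isTopologicalBasis_mk_eq_weight H
  have hchar (b : B) (hob : o ∈ (b : Set H)) : ∃ F : Finset (DualGroup K),
      ∀ x, f x ∈ dualCoannihilator (F : Set (DualGroup K)) → x ∈ (b : Set H) := by
    have hb : (b : Set H) ∈ 𝓝 o := (hB.isOpen b.2).mem_nhds hob
    rw [hf.nhds_eq_comap, Filter.mem_comap, ho] at hb
    obtain ⟨U, hU, hUb⟩ := hb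
    obtain ⟨F, hF⟩ := exists_finset_dualCoannihilator_subset hU
    exact ⟨F, fun x hx ↦ hUb (hF hx)⟩
  choose! F hF using hchar
  refine ⟨⋃ b : B, (F b : Set (DualGroup K)), ?_, fun x hx ↦ by_contra fun hne ↦ ?_⟩
  · refine (mk_iUnion_le _).trans (mul_le_of_le hw hBw.le (ciSup_le' fun b ↦ ?_))
    exact (F b).countable_toSet.le_aleph0.trans hw
  · obtain ⟨b, hb, hob, hbx⟩ := hB.exists_subset_of_mem_open
      (Set.mem_compl_singleton_iff.2 (Ne.symm hne)) isOpen_compl_singleton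
    exact hbx (hF ⟨b, hb⟩ hob x (dualCoannihilator_anti
      (Set.subset_iUnion (fun b : B ↦ (F b : Set (DualGroup K))) ⟨b, hb⟩) hx)) rfl

theorem weight_connectedComponentOfZero_le_of_countable {M : AddSubgroup K}
    (hM : AddSubgroup.connectedComponentOfZero M ≠ ⊥) {B : Set (DualGroup K)} (hB : B.Countable)
    (hBM : ∀ t : Set K, IsPreconnected t → 0 ∈ t → t ⊆ dualCoannihilator B → t ⊆ M) :
    weight (AddSubgroup.connectedComponentOfZero K) ≤
      weight (AddSubgroup.connectedComponentOfZero M) := by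
  have : Nontrivial (AddSubgroup.connectedComponentOfZero M) :=
    (AddSubgroup.nontrivial_iff_ne_bot _).2 hM
  have hw := aleph0_le_weight (AddSubgroup.connectedComponentOfZero M)
  obtain ⟨A, hA, hAM⟩ := exists_mk_le_weight_forall_mem_dualCoannihilator_eq
    (isInducing_coe_coe_connectedComponentOfZero M) (o := 0) rfl hw
  refine weight_connectedComponentOfZero_le (A := A ∪ B)
    (isTotallyDisconnected_of_forall_isPreconnected_zero_mem fun t ht h0 htAB x hx ↦ ?_) hw
    ((mk_union_le A B).trans (add_le_of_le hw hA (hB.le_aleph0.trans hw)))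
  have htM : t ⊆ M := hBM t ht h0 (htAB.trans (dualCoannihilator_anti Set.subset_union_right))
  obtain ⟨y, rfl⟩ := exists_mem_connectedComponentOfZero_coe_coe_eq ht h0 htM hx
  rw [hAM y (dualCoannihilator_anti Set.subset_union_left (htAB hx))]
  rfl

theorem exists_countable_dualCoannihilator_le_of_isGδ {M : AddSubgroup K}
    (hM : IsGδ (M : Set K)) : ∃ B : Set (DualGroup K), B.Countable ∧ dualCoannihilator B ≤ M := by
  obtain ⟨T, hTo, hTc, hMT⟩ := hM
  have h0 (U : T) : (0 : K) ∈ (U : Set K) := (hMT ▸ M.zero_mem : (0 : K) ∈ ⋂₀ T) U U.2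
  choose F hF using fun U : T ↦
    exists_finset_dualCoannihilator_subset ((hTo U U.2).mem_nhds (h0 U))
  have : Countable T := hTc.to_subtype
  refine ⟨⋃ U : T, (F U : Set (DualGroup K)),
    Set.countable_iUnion fun U ↦ (F U).countable_toSet, fun x hx ↦ ?_⟩
  rw [← SetLike.mem_coe, hMT]
  exact fun U hU ↦ hF ⟨U, hU⟩ (dualCoannihilator_anti
    (Set.subset_iUnion (fun U : T ↦ (F U : Set (DualGroup K))) ⟨U, hU⟩) hx)

end ConnectedComponent

/-! ### Locally essential subgroups -/

section LocallyEssential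

variable {K : Type u} [AddCommGroup K] [TopologicalSpace K] [IsTopologicalAddGroup K]
  [CompactSpace K] {M : AddSubgroup K}

theorem subset_of_isPreconnected_of_subset_dualCoannihilator (hM : IsClosed (M : Set K))
    {A : Set (DualGroup K)} (hA : ∀ χ ∈ dualAnnihilator (M : Set K),
      ∃ n : ℕ, 0 < n ∧ n • χ ∈ AddSubgroup.closure A)
    {t : Set K} (ht : IsPreconnected t) (h0 : 0 ∈ t) (htA : t ⊆ dualCoannihilator A) :
    t ⊆ M := by
  refine fun x hx ↦ by_contra fun hxM ↦ ?_
  obtain ⟨χ, hχM, hχ⟩ := exists_mem_dualAnnihilator_apply_ne_zero hM hxM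
  obtain ⟨n, hn, hnχ⟩ := hA χ hχM
  refine hχ (dualGroup_apply_eq_zero_of_isPreconnected ht h0 χ hn (fun y hy ↦ ?_) hx)
  rw [← ContinuousAddMonoidHom.nsmul_apply]
  exact closure_le_dualAnnihilator_dualCoannihilator A hnχ y (htA hy)

variable [T2Space K]

theorem exists_finset_forall_eq_top_of_isLocallyEssential (h : IsLocallyEssential M) :
    ∃ F : Finset (DualGroup K), ∀ B : AddSubgroup (DualGroup K), (F : Set (DualGroup K)) ⊆ B →
      dualAnnihilator (M : Set K) ⊔ B = ⊤ → B = ⊤ := by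
  obtain ⟨V, hV, hess⟩ := h
  obtain ⟨F, hF⟩ := exists_finset_dualCoannihilator_subset hV
  refine ⟨F, fun B hFB hMB ↦ by_contra fun hB ↦ ?_⟩
  refine hess (dualCoannihilator B) inferInstance (isClosed_dualCoannihilator _)
    (mt eq_top_of_dualCoannihilator_eq_bot hB)
    (subset_trans (dualCoannihilator_anti hFB) hF) ((AddSubgroup.eq_bot_iff_forall _).2 ?_)
  rintro x ⟨hxM, hxB⟩
  by_contra hx
  obtain ⟨χ, hχ⟩ := exists_dualGroup_apply_ne_zero hx
  obtain ⟨φ, hφ, ψ, hψ, rfl⟩ := AddSubgroup.mem_sup.1 (hMB ▸ AddSubgroup.mem_top χ)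
  exact hχ (by rw [ContinuousAddMonoidHom.add_apply, hφ x hxM, hxB ψ hψ, add_zero])

theorem connectedComponentOfZero_ne_bot_of_coveringDimension_eq_top
    (hK : coveringDimension K = ⊤) {S : Finset (DualGroup K)}
    (hSM : ∀ t : Set K, IsPreconnected t → 0 ∈ t →
      t ⊆ dualCoannihilator (S : Set (DualGroup K)) → t ⊆ M) :
    AddSubgroup.connectedComponentOfZero M ≠ ⊥ := by
  refine fun hM ↦ coveringDimension_ne_top
    (hasCoveringDimensionLT_of_isTotallyDisconnected_dualCoannihilator (S := S)
      (isTotallyDisconnected_of_forall_isPreconnected_zero_mem fun t ht h0 htS x hx ↦ ?_)) hK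
  obtain ⟨y, rfl⟩ :=
    exists_mem_connectedComponentOfZero_coe_coe_eq ht h0 (hSM t ht h0 htS) hx
  exact congrArg Subtype.val ((AddSubgroup.eq_bot_iff_forall _).1 hM y y.2)

end LocallyEssential

theorem mainTheorem11 {K : Type u} [AddCommGroup K] [TopologicalSpace K]
    [IsTopologicalAddGroup K] [T2Space K] [CompactSpace K]
    (M : AddSubgroup K) (hM : IsClosed (M : Set K))
    (h : (IsGδ (M : Set K) ∧ AddSubgroup.connectedComponentOfZero M ≠ ⊥) ∨
      (IsLocallyEssential M ∧ coveringDimension K = ⊤)) :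
    weight (AddSubgroup.connectedComponentOfZero M) =
      weight (AddSubgroup.connectedComponentOfZero K) := by
  refine (weight_connectedComponentOfZero_mono M).antisymm ?_
  obtain ⟨hMδ, hMc⟩ | ⟨hMess, hdim⟩ := h
  · obtain ⟨B, hB, hBM⟩ := exists_countable_dualCoannihilator_le_of_isGδ hMδ
    exact weight_connectedComponentOfZero_le_of_countable hMc hB fun t _ _ htB ↦ htB.trans hBM
  · obtain ⟨F, hF⟩ := exists_finset_forall_eq_top_of_isLocallyEssential hMess
    obtain ⟨S, hS⟩ := exists_finset_forall_nsmul_mem_closure hF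
    have hSM (t : Set K) (ht : IsPreconnected t) (h0 : 0 ∈ t) :=
      subset_of_isPreconnected_of_subset_dualCoannihilator hM hS ht h0
    exact weight_connectedComponentOfZero_le_of_countable
      (connectedComponentOfZero_ne_bot_of_coveringDimension_eq_top hdim hSM)
      S.countable_toSet hSM
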